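/- Let $M$ be a complex Hilbert space, $B(M)$ the bounded linear operators on $M$, and $D=\mathbb C\setminus((-\infty,-1]\cup[1,\infty))$. Operator inequalities are in the sense of quadratic forms, and $\operatorname{Im}A=(A-A^*)/(2i)$ for $A\in B(M)$. A Nevanlinna function on $D$ is a holomorphic function $F:D\to B(M)$ with $F(z)^*=F(\bar z)$ and $\operatorname{Im}z\,\operatorname{Im}F(z)\ge 0$ for all $z$ with $\operatorname{Im}z\ne 0$. The class $\mathcal{RS}(M)$ consists of the Nevanlinna functions $F$ on $D$ with $-I\le F(x)\le I$ for all $x\in(-1,1)$. **Theorem 4.1.** Let $\Omega$ be a $B(M)$-valued Nevanlinna function on $D$. The following statements are equivalent: (i) $\Omega\in\mathcal{RS}(M)$; (ii) $I-\Omega(z)^*\Omega(z)-(1-|z|^2)\dfrac{\operatorname{Im}\Omega(z)}{\operatorname{Im}z}\ge 0$ for all $z$ with $\operatorname{Im}z\ne 0$; (iii) $K(z,w)=I-\Omega(w)^*\Omega(z)-\dfrac{1-\bar w z}{z-\bar w}\,(\Omega(z)-\Omega(w)^*)$ is a nonnegative kernel on $D\cap\{\operatorname{Im}z>0\}$ and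 on $D\cap\{\operatorname{Im}z<0\}$; that is, in each of these two sets, $\sum_{k,m=1}^n (K(z_k,z_m)f_k,f_m)\ge 0$ for all $n$, all points $z_1,\dots,z_n$ of the set and all $f_1,\dots,f_n\in M$; (iv) for every $z\in D$ the operator $I-z\Omega(z)$ has a bounded inverse on $M$, and the function $\Upsilon(z)=(zI-\Omega(z))(I-z\Omega(z))^{-1}$, $z\in D$, belongs to $\mathcal{RS}(M)$. -/

import Mathlib

open scoped ComplexStarModule

/-- The domain `ℂ ∖ ((-∞, -1] ∪ [1, ∞))`. -/
def cutPlane : Set ℂ :=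
  ((fun x : ℝ => (x : ℂ)) '' (Set.Iic (-1) ∪ Set.Ici 1))ᶜ

section

variable {M : Type*} [NormedAddCommGroup M] [InnerProductSpace ℂ M] [CompleteSpace M]

/-- A `B(M)`-valued Nevanlinna function: holomorphic outside the real axis, symmetric, and with
`Im z • Im F(z) ≥ 0`. The operator order is the Loewner order, and `ℑ A = (A - A*) / (2i)`. -/
structure IsNevanlinna (F : ℂ → M →L[ℂ] M) : Prop where
  holo : DifferentiableOn ℂ F {z : ℂ | z.im ≠ 0}
  symm : ∀ z : ℂ, z.im ≠ 0 → star (F z) = F (starRingEnd ℂ z)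
  im_nonneg : ∀ z : ℂ, z.im ≠ 0 → 0 ≤ (z.im : ℂ) • (ℑ (F z) : M →L[ℂ] M)

/-- A `B(M)`-valued Nevanlinna function on `cutPlane`: it is holomorphic on all of `cutPlane`,
including the real interval `(-1, 1)`. Values outside `cutPlane` play no role. -/
structure IsNevanlinnaOnCutPlane (F : ℂ → M →L[ℂ] M) : Prop where
  nevanlinna : IsNevanlinna F
  holo : DifferentiableOn ℂ F cutPlane

/-- The combined Nevanlinna-Schur class `RS(M)`. -/
structure IsRS (F : ℂ → M →L[ℂ] M) : Prop where
  nevanlinna : IsNevanlinnaOnCutPlane F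
  bounds : ∀ x : ℝ, x ∈ Set.Ioo (-1 : ℝ) 1 → -1 ≤ F (x : ℂ) ∧ F (x : ℂ) ≤ 1

open scoped ComplexOrder in
/-- `K` is a nonnegative kernel on `D`: for all finite families of points `z k ∈ D` and vectors
`f k`, the sum of `(K(z k, z m) f k, f m)` over `k`, `m` is real and nonnegative.
(Mathlib's `inner ℂ` is linear in its second argument.) -/
def IsNonnegKernelOn (K : ℂ → ℂ → M →L[ℂ] M) (D : Set ℂ) : Prop :=
  ∀ (n : ℕ) (z : Fin n → ℂ) (f : Fin n → M), (∀ k, z k ∈ D) →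
    0 ≤ ∑ k, ∑ m, inner ℂ (f m) (K (z k) (z m) (f k))

/-- `K(z,w) = I - Ω(w)* Ω(z) - ((1 - w̄ z) / (z - w̄)) (Ω(z) - Ω(w)*)`. -/
noncomputable def rsKernel (Ω : ℂ → M →L[ℂ] M) (z w : ℂ) : M →L[ℂ] M :=
  1 - star (Ω w) * Ω z -
    ((1 - starRingEnd ℂ w * z) / (z - starRingEnd ℂ w)) • (Ω z - star (Ω w))

/-- `Υ(z) = (zI - Ω(z)) (I - zΩ(z))⁻¹`; `Ring.inverse` is the inverse in `B(M)`, and this is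
meaningful where `I - zΩ(z)` is a unit of `B(M)`, that is, boundedly invertible. -/
noncomputable def rsTransform (Ω : ℂ → M →L[ℂ] M) (z : ℂ) : M →L[ℂ] M :=
  (z • 1 - Ω z) * Ring.inverse (1 - z • Ω z)

end

/-!
The proof runs through the cycle `IsRS Ω → Υ ∈ RS → nonnegative kernel → inequality on the diagonal
→ IsRS Ω`. Throughout, operator inequalities are read as inequalities between the quadratic forms
`inner ℂ f (T f)`.

The analytic core is the operator Schwarz-Pick inequality for `F` in the class `RS`
(`IsRS.schwarz_pick`). It rests on a bound for scalar functions
(`im_div_nonpos_of_nonneg_on_interval`): if `a` is holomorphic on `cutPlane`, has nonnegative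
imaginary part in the upper half-plane and is nonnegative on `(-1, 1)`, then
`0 ≤ arg (a z) ≤ arg ((1 + z) / (1 - z))` there. In the coordinate `w = log ((1 + z) / (1 - z))` the
upper half-plane is the strip `0 < Im w < π`, and the bound `arg a ≤ Im w` holds on its boundary;
it extends inside by the Phragmén-Lindelöf principle. The bound is applied not to `F` but to the forms
of the Cayley transform `(1 - F) (1 + F)⁻¹ = 2 (1 + F)⁻¹ - 1`; evaluated at the vector `(1 + F z) h`,
it is exactly the Schwarz-Pick inequality for `F z` at `h`. The operator `1 + F` is made invertible
by replacing `F` with `r F + (1 - r) z`, and then `r → 1`.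

The rest is algebra and Cauchy's formula. `1 - z F z` is invertible because `z⁻¹ - F z` has strictly
definite imaginary part off the real axis (`IsRS.isUnit_one_sub_smul`). With `g = (1 - z F z) f` one
has `Im (Υ z g, g) = Im ((z - F z) f, (1 - z F z) f)`, which is `Im z` times the Schwarz-Pick form, so
`Υ` is a Nevanlinna function (`IsRS.isRS_rsTransform`). Conversely, the kernel `rsKernel Ω` is
congruent, through `1 - z Ω z`, to the Nevanlinna kernel `(Υ z - (Υ w)*) / (z - conj w)`
(`rsKernel_eq`), and the Nevanlinna kernel is nonnegative on each half-plane: after a Cayley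
transform to the disc, Cauchy's formula writes its sums as circle averages of nonnegative forms
(`IsNevanlinna.kernel_nonneg_upper`). Finally, inside the unit disc the Schwarz-Pick inequality gives
`‖Ω z f‖ ≤ ‖f‖` off the real axis, hence by continuity on `(-1, 1)`
(`IsNevanlinnaOnCutPlane.isRS_of_schwarz_pick`).
-/

/-! ### The slit domain -/

theorem isOpen_cutPlane : IsOpen cutPlane := by
  refine IsClosed.isOpen_compl (self := ?_)
  exact Complex.isometry_ofReal.isClosedEmbedding.isClosedMap _ (isClosed_Iic.union isClosed_Ici)

theorem mem_cutPlane_of_im_ne_zero {z : ℂ} (hz : z.im ≠ 0) : z ∈ cutPlane := by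
  rintro ⟨x, -, rfl⟩
  exact hz (Complex.ofReal_im x)

theorem ofReal_mem_cutPlane {x : ℝ} : (x : ℂ) ∈ cutPlane ↔ x ∈ Set.Ioo (-1 : ℝ) 1 := by
  simp [cutPlane, not_or]

theorem cutPlane_cases {z : ℂ} (hz : z ∈ cutPlane) :
    z.im ≠ 0 ∨ ∃ x ∈ Set.Ioo (-1 : ℝ) 1, (x : ℂ) = z := by
  by_cases h : z.im = 0
  · right
    have e : ((z.re : ℝ) : ℂ) = z := Complex.ext (by simp) (by simp [h])
    exact ⟨z.re, ofReal_mem_cutPlane.1 (e ▸ hz), e⟩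
  · exact Or.inl h

theorem neg_mem_cutPlane {z : ℂ} (hz : z ∈ cutPlane) : -z ∈ cutPlane := by
  rcases cutPlane_cases hz with h | ⟨x, hx, rfl⟩
  · exact mem_cutPlane_of_im_ne_zero (by simpa using h)
  · rw [← Complex.ofReal_neg, ofReal_mem_cutPlane]
    exact ⟨by linarith [hx.2], by linarith [hx.1]⟩

theorem one_add_ne_zero_of_mem_cutPlane {z : ℂ} (hz : z ∈ cutPlane) : 1 + z ≠ 0 := by
  intro h
  have : z = ((-1 : ℝ) : ℂ) := by push_cast; linear_combination h
  rw [this, ofReal_mem_cutPlane] at hz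
  exact lt_irrefl _ hz.1

theorem one_sub_ne_zero_of_mem_cutPlane {z : ℂ} (hz : z ∈ cutPlane) : 1 - z ≠ 0 := by
  have := one_add_ne_zero_of_mem_cutPlane (neg_mem_cutPlane hz)
  rwa [← sub_eq_add_neg] at this

/-- Vertical approach to a point of the real axis. -/
theorem tendsto_vertical {E : Type*} [TopologicalSpace E] {G : ℂ → E} {x : ℝ}
    (hG : ContinuousAt G x) :
    Filter.Tendsto (fun y : ℝ => G (x + y * Complex.I)) (nhdsWithin 0 (Set.Ioi 0)) (nhds (G x)) := by
  have h : Continuous fun y : ℝ => (x : ℂ) + y * Complex.I := by fun_prop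
  have h0 := h.tendsto 0
  simp only [Complex.ofReal_zero, zero_mul, add_zero] at h0
  exact (hG.tendsto.comp h0).mono_left nhdsWithin_le_nhds

section

variable {M : Type*} [NormedAddCommGroup M] [InnerProductSpace ℂ M] [CompleteSpace M]

/-! ### Operator inequalities as inequalities between quadratic forms -/

theorem nonneg_iff_inner_of_isSelfAdjoint {T : M →L[ℂ] M} (hT : star T = T) :
    0 ≤ T ↔ ∀ f, 0 ≤ (inner ℂ f (T f)).re := by
  rw [ContinuousLinearMap.nonneg_iff_isPositive, ContinuousLinearMap.isPositive_def]
  have hs : (T : M →ₗ[ℂ] M).IsSymmetric :=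
    (ContinuousLinearMap.isSelfAdjoint_iff_isSymmetric).1 hT
  refine ⟨fun h f => ?_, fun h => ⟨hs, fun f => ?_⟩⟩
  · have := h.2 f
    rwa [ContinuousLinearMap.reApplyInnerSelf_apply, inner_re_symm] at this
  · rw [ContinuousLinearMap.reApplyInnerSelf_apply, inner_re_symm]
    exact h f

theorem star_imaginaryPart (A : M →L[ℂ] M) :
    star (ℑ A : M →L[ℂ] M) = (ℑ A : M →L[ℂ] M) := (ℑ A).2

theorem inner_imaginaryPart_re (A : M →L[ℂ] M) (f : M) :
    (inner ℂ f ((ℑ A : M →L[ℂ] M) f)).re = (inner ℂ f (A f)).im := by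
  have h : inner ℂ f (star A f) = starRingEnd ℂ (inner ℂ f (A f)) := by
    rw [ContinuousLinearMap.star_eq_adjoint, ContinuousLinearMap.adjoint_inner_right,
      inner_conj_symm]
  have h2 : inner ℂ f ((A - star A) f) = ((2 * (inner ℂ f (A f)).im : ℝ) : ℂ) * Complex.I := by
    rw [sub_apply, inner_sub_right, h, Complex.sub_conj]
  rw [imaginaryPart_apply_coe, smul_apply, inner_smul_right, smul_apply, ← Complex.coe_smul,
    inner_smul_right, h2]
  simp

theorem im_smul_nonneg_iff {A : M →L[ℂ] M} {y : ℝ} :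
    0 ≤ (y : ℂ) • (ℑ A : M →L[ℂ] M) ↔ ∀ f, 0 ≤ y * (inner ℂ f (A f)).im := by
  rw [nonneg_iff_inner_of_isSelfAdjoint (by rw [star_smul, star_imaginaryPart]; simp)]
  refine forall_congr' fun f => ?_
  rw [smul_apply, inner_smul_right, Complex.re_ofReal_mul,
    inner_imaginaryPart_re]

theorem inner_star_mul_self (A : M →L[ℂ] M) (f : M) :
    (inner ℂ f ((star A * A) f)) = ((‖A f‖ ^ 2 : ℝ) : ℂ) := by
  rw [mul_apply_eq_comp, ContinuousLinearMap.star_eq_adjoint,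
    ContinuousLinearMap.adjoint_inner_right, inner_self_eq_norm_sq_to_K]
  simp

/-- The quadratic form of `1 - A* A - c Im A`. -/
theorem one_sub_star_mul_self_sub_smul_nonneg_iff {A : M →L[ℂ] M} {c : ℝ} :
    0 ≤ 1 - star A * A - (c : ℂ) • (ℑ A : M →L[ℂ] M) ↔
      ∀ f, 0 ≤ ‖f‖ ^ 2 - ‖A f‖ ^ 2 - c * (inner ℂ f (A f)).im := by
  rw [nonneg_iff_inner_of_isSelfAdjoint
    (by simp)]
  refine forall_congr' fun f => ?_
  rw [sub_apply, sub_apply, inner_sub_right,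
    inner_sub_right, inner_star_mul_self, smul_apply, inner_smul_right,
    one_apply_eq_self, inner_self_eq_norm_sq_to_K, Complex.sub_re, Complex.sub_re,
    Complex.re_ofReal_mul, inner_imaginaryPart_re, Complex.ofReal_re]
  norm_cast

theorem neg_one_le_and_le_one_iff {T : M →L[ℂ] M} (hT : star T = T) :
    (-1 ≤ T ∧ T ≤ 1) ↔ ∀ f, |(inner ℂ f (T f)).re| ≤ ‖f‖ ^ 2 := by
  rw [← sub_nonneg, ← sub_nonneg (b := T), nonneg_iff_inner_of_isSelfAdjoint (by simp [hT]),
    nonneg_iff_inner_of_isSelfAdjoint (by simp [hT]), ← forall_and]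
  refine forall_congr' fun f => ?_
  have h1 : (inner ℂ f f).re = ‖f‖ ^ 2 := by
    rw [inner_self_eq_norm_sq_to_K]; norm_cast
  rw [abs_le]
  simp only [sub_apply, neg_apply,
    one_apply_eq_self, inner_sub_right, inner_neg_right, Complex.sub_re,
    Complex.neg_re, h1]
  constructor <;> rintro ⟨_, _⟩ <;> constructor <;> linarith

/-- For self-adjoint `T`, the form bounds `-I ≤ T ≤ I` amount to `T` being a contraction. -/
theorem norm_apply_le_of_bounds {T : M →L[ℂ] M} (h : -1 ≤ T ∧ T ≤ 1) (f : M) : ‖T f‖ ≤ ‖f‖ := by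
  have hsa : star T = T := by
    have := (ContinuousLinearMap.le_def _ _).1 h.2 |>.isSelfAdjoint.star_eq
    simpa using this
  have hT : ‖T‖ ≤ 1 := by
    rw [T.norm_eq_iSup_rayleighQuotient
      ((ContinuousLinearMap.isSelfAdjoint_iff_isSymmetric).1 hsa)]
    refine ciSup_le fun f => ?_
    rw [ContinuousLinearMap.rayleighQuotient, ContinuousLinearMap.reApplyInnerSelf_apply,
      inner_re_symm, abs_div, abs_of_nonneg (sq_nonneg ‖f‖)]
    exact div_le_one_of_le₀ ((neg_one_le_and_le_one_iff hsa).1 h f) (sq_nonneg _)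
  simpa using T.le_of_opNorm_le hT f

/-- A numerical range separated from `0` by a half-plane makes an operator invertible. -/
theorem isUnit_of_re_inner_ge {T : M →L[ℂ] M} (c : ℂ) {δ : ℝ} (hδ : 0 < δ)
    (h : ∀ f, δ * ‖f‖ ^ 2 ≤ (c * inner ℂ f (T f)).re) : IsUnit T := by
  have hc : 0 < ‖c‖ + 1 := by positivity
  refine ContinuousLinearMap.isUnit_of_forall_le_norm_inner_map T
    (c := ⟨δ / (‖c‖ + 1), by positivity⟩) (show 0 < δ / (‖c‖ + 1) by positivity) fun f => ?_
  have h1 : δ * ‖f‖ ^ 2 ≤ ‖c‖ * ‖inner ℂ f (T f)‖ :=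
    (h f).trans ((Complex.re_le_norm _).trans_eq (norm_mul _ _))
  rw [norm_inner_symm]
  have h2 : ‖f‖ ^ 2 * (δ / (‖c‖ + 1)) = δ * ‖f‖ ^ 2 / (‖c‖ + 1) := by ring
  refine h2.trans_le ?_
  rw [div_le_iff₀ hc]
  nlinarith [norm_nonneg (inner ℂ f (T f))]

/-! ### Nevanlinna functions on the slit domain -/

theorem IsNevanlinnaOnCutPlane.continuousAt {F : ℂ → M →L[ℂ] M} (hF : IsNevanlinnaOnCutPlane F)
    {z : ℂ} (hz : z ∈ cutPlane) : ContinuousAt F z :=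
  (hF.holo.differentiableAt (isOpen_cutPlane.mem_nhds hz)).continuousAt

theorem IsNevanlinnaOnCutPlane.star_ofReal {F : ℂ → M →L[ℂ] M} (hF : IsNevanlinnaOnCutPlane F)
    {x : ℝ} (hx : x ∈ Set.Ioo (-1 : ℝ) 1) : star (F x) = F x := by
  have hc := hF.continuousAt (ofReal_mem_cutPlane.2 hx)
  have h1 : ContinuousAt (fun z => star (F z)) (x : ℂ) := hc.star
  have h2 : ContinuousAt (fun z => F (starRingEnd ℂ z)) (x : ℂ) := by
    refine ContinuousAt.comp (f := starRingEnd ℂ) ?_ Complex.continuous_conj.continuousAt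
    rwa [Complex.conj_ofReal]
  have h3 := tendsto_nhds_unique_of_eventuallyEq (tendsto_vertical h1) (tendsto_vertical h2) ?_
  · simpa using h3
  · filter_upwards [self_mem_nhdsWithin] with y hy
    exact hF.nevanlinna.symm _ (by simpa using (ne_of_gt hy))

theorem IsNevanlinna.mul_im_inner_nonneg {F : ℂ → M →L[ℂ] M} (hF : IsNevanlinna F)
    {z : ℂ} (hz : z.im ≠ 0) (f : M) : 0 ≤ z.im * (inner ℂ f (F z f)).im :=
  im_smul_nonneg_iff.1 (hF.im_nonneg z hz) f

theorem IsNevanlinnaOnCutPlane.inner_ofReal_im {F : ℂ → M →L[ℂ] M}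
    (hF : IsNevanlinnaOnCutPlane F) {x : ℝ} (hx : x ∈ Set.Ioo (-1 : ℝ) 1) (f : M) :
    (inner ℂ f (F x f)).im = 0 := by
  have h := inner_conj_symm (𝕜 := ℂ) f (F x f)
  rw [← ContinuousLinearMap.adjoint_inner_right, ← ContinuousLinearMap.star_eq_adjoint,
    hF.star_ofReal hx] at h
  exact Complex.conj_eq_iff_im.1 h

theorem IsNevanlinnaOnCutPlane.isRS_iff {F : ℂ → M →L[ℂ] M} (hF : IsNevanlinnaOnCutPlane F) :
    IsRS F ↔ ∀ x : ℝ, x ∈ Set.Ioo (-1 : ℝ) 1 → ∀ f, |(inner ℂ f (F x f)).re| ≤ ‖f‖ ^ 2 :=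
  ⟨fun h x hx => (neg_one_le_and_le_one_iff (hF.star_ofReal hx)).1 (h.bounds x hx),
    fun h => ⟨hF, fun x hx => (neg_one_le_and_le_one_iff (hF.star_ofReal hx)).2 (h x hx)⟩⟩

theorem IsNevanlinna.neg_comp_neg {F : ℂ → M →L[ℂ] M} (hF : IsNevanlinna F) :
    IsNevanlinna fun z => -F (-z) where
  holo := (hF.holo.comp (differentiableOn_neg _) fun z hz => by simpa using hz).neg
  symm z hz := by rw [star_neg, hF.symm _ (by simpa using hz), map_neg]
  im_nonneg z hz := by
    rw [im_smul_nonneg_iff]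
    intro f
    have := hF.mul_im_inner_nonneg (z := -z) (by simpa using hz) f
    simpa using this

theorem IsNevanlinnaOnCutPlane.neg_comp_neg {F : ℂ → M →L[ℂ] M} (hF : IsNevanlinnaOnCutPlane F) :
    IsNevanlinnaOnCutPlane fun z => -F (-z) where
  nevanlinna := hF.nevanlinna.neg_comp_neg
  holo := (hF.holo.comp (differentiableOn_neg _) fun _ hz => neg_mem_cutPlane hz).neg

theorem IsRS.neg_comp_neg {F : ℂ → M →L[ℂ] M} (hF : IsRS F) : IsRS fun z => -F (-z) := by
  rw [hF.nevanlinna.neg_comp_neg.isRS_iff]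
  intro x hx f
  have := hF.nevanlinna.isRS_iff.1 hF (-x) ⟨by linarith [hx.2], by linarith [hx.1]⟩ f
  simpa using this

end

/-! ### An angular bound for scalar functions -/

/-- In the strip coordinate: a function with argument in `[0, π]` on the strip `0 < Im w < π` and
argument `0` on the real axis has argument at most `Im w`. -/
theorem arg_le_im_of_strip {g : ℂ → ℂ}
    (hd : ∀ w : ℂ, 0 ≤ w.im → w.im < Real.pi → DifferentiableAt ℂ g w)
    (him : ∀ w : ℂ, 0 < w.im → w.im < Real.pi → 0 < (g w).im)
    (hre : ∀ w : ℂ, w.im = 0 → 0 < (g w).re ∧ (g w).im = 0)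
    {w : ℂ} (hw0 : 0 < w.im) (hw : w.im < Real.pi) : (g w).arg ≤ w.im := by
  have hslit : ∀ v : ℂ, 0 ≤ v.im → v.im < Real.pi → g v ∈ Complex.slitPlane := by
    intro v h0 h1
    rcases h0.eq_or_lt with h | h
    · exact Or.inl (hre v h.symm).1
    · exact Or.inr (him v h h1).ne'
  -- The modulus of `exp (-i (log (g v) - (π / b) v))` is `exp (arg (g v) - (π / b) Im v)`. The strip
  -- stops at `b < π` because nothing is known about `g` on the line `Im v = π`.
  have key : ∀ b, w.im < b → b < Real.pi → (g w).arg ≤ Real.pi / b * w.im := by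
    intro b hwb hb
    have hb0 : 0 < b := hw0.trans hwb
    set h : ℂ → ℂ := fun v => Complex.exp (-Complex.I *
      (Complex.log (g v) - ((Real.pi / b : ℝ) : ℂ) * v)) with hh
    have hn : ∀ v, ‖h v‖ = Real.exp ((g v).arg - Real.pi / b * v.im) := by
      intro v
      rw [hh, Complex.norm_exp]
      congr 1
      simp [Complex.log_im]
    have hdiff : ∀ v : ℂ, 0 ≤ v.im → v.im < Real.pi → DifferentiableAt ℂ h v := by
      intro v h0 h1
      exact ((((hd v h0 h1).clog (hslit v h0 h1)).sub
        (differentiableAt_id.const_mul _)).const_mul _).cexp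
    have hcl : closure (Complex.im ⁻¹' Set.Ioo 0 b) ⊆ Complex.im ⁻¹' Set.Icc 0 b :=
      closure_minimal (Set.preimage_mono Set.Ioo_subset_Icc_self)
        (isClosed_Icc.preimage Complex.continuous_im)
    have h1 : ‖h w‖ ≤ 1 := by
      refine PhragmenLindelof.horizontal_strip (a := 0) (b := b) ?_
        ⟨0, by rw [sub_zero]; positivity, 0, ?_⟩ ?_ ?_ hw0.le hwb.le
      · refine DifferentiableOn.diffContOnCl fun v hv => ?_
        have := hcl hv
        exact (hdiff v this.1 (this.2.trans_lt hb)).differentiableWithinAt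
      · refine Asymptotics.IsBigO.of_bound (Real.exp Real.pi) ?_
        refine Filter.eventually_inf_principal.2 (Filter.Eventually.of_forall fun v hv => ?_)
        rw [hn]
        simp only [zero_mul, Real.exp_zero, norm_one, mul_one]
        refine Real.exp_le_exp.2 ?_
        have : 0 ≤ Real.pi / b * v.im := mul_nonneg (by positivity) hv.1.le
        linarith [Complex.arg_le_pi (g v)]
      · intro v hv
        rw [hn, hv, Complex.arg_eq_zero_iff.2 ⟨(hre v hv).1.le, (hre v hv).2⟩]
        simp
      · intro v hv
        rw [hn, hv, div_mul_cancel₀ _ hb0.ne']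
        exact Real.exp_le_one_iff.2 (by linarith [Complex.arg_le_pi (g v)])
    rw [hn, Real.exp_le_one_iff] at h1
    linarith
  have hlim : Filter.Tendsto (fun b : ℝ => Real.pi / b * w.im)
      (nhdsWithin Real.pi (Set.Iio Real.pi)) (nhds w.im) := by
    have : ContinuousAt (fun b : ℝ => Real.pi / b * w.im) Real.pi := by
      have := Real.pi_ne_zero
      fun_prop (disch := assumption)
    have h2 := this.tendsto
    rw [div_self Real.pi_ne_zero, one_mul] at h2
    exact h2.mono_left nhdsWithin_le_nhds
  refine ge_of_tendsto hlim ?_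
  filter_upwards [Ioo_mem_nhdsLT hw] with b hb
  exact key b hb.1 hb.2

/-- The conclusion `arg u ≤ Im w`, for `Im u ≥ 0`, as the sign of one imaginary part. -/
theorem im_mul_exp_neg_nonpos {u w : ℂ} (hu : 0 ≤ u.im) (hw : w.im ≤ Real.pi)
    (h : u.arg ≤ w.im) : (u * Complex.exp (-w)).im ≤ 0 := by
  have h0 : 0 ≤ u.arg := Complex.arg_nonneg_iff.2 hu
  have e : u * Complex.exp (-w) =
      (‖u‖ : ℂ) * Complex.exp ((-w.re : ℝ) + (u.arg - w.im : ℝ) * Complex.I) := by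
    conv_lhs => rw [← Complex.norm_mul_exp_arg_mul_I u]
    rw [mul_assoc, ← Complex.exp_add]
    congr 2
    apply Complex.ext <;> simp
    ring
  rw [e, Complex.im_ofReal_mul, Complex.exp_im]
  simp only [Complex.add_im, Complex.ofReal_im, Complex.mul_im, Complex.I_im, Complex.I_re,
    Complex.ofReal_re, mul_one, mul_zero, add_zero, zero_add]
  have : Real.sin (u.arg - w.im) ≤ 0 :=
    Real.sin_nonpos_of_nonpos_of_neg_pi_le (by linarith) (by linarith)
  exact mul_nonpos_of_nonneg_of_nonpos (norm_nonneg _)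
    (mul_nonpos_of_nonneg_of_nonpos (Real.exp_pos _).le this)

/-- A holomorphic function on `cutPlane` that has nonnegative imaginary part in the upper half-plane
and is nonnegative on `(-1, 1)` takes values in the angle `0 ≤ arg ≤ arg ((1 + z) / (1 - z))`. -/
theorem im_div_nonpos_of_nonneg_on_interval {a : ℂ → ℂ} (hd : DifferentiableOn ℂ a cutPlane)
    (him : ∀ z : ℂ, 0 < z.im → 0 ≤ (a z).im)
    (hre : ∀ x : ℝ, x ∈ Set.Ioo (-1 : ℝ) 1 → 0 ≤ (a x).re ∧ (a x).im = 0)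
    {z : ℂ} (hz : 0 < z.im) : (a z * ((1 - z) / (1 + z))).im ≤ 0 := by
  set p : ℂ → ℂ := fun w => (Complex.exp w - 1) / (Complex.exp w + 1) with hp
  have hpos : ∀ w : ℂ, 0 ≤ w.im → w.im < Real.pi → Complex.exp w + 1 ≠ 0 := by
    intro w h0 h1 h
    have hi := congrArg Complex.im h
    have hr := congrArg Complex.re h
    simp only [Complex.add_im, Complex.exp_im, Complex.one_im, Complex.zero_im, add_zero,
      Complex.add_re, Complex.exp_re, Complex.one_re, Complex.zero_re] at hi hr
    rcases h0.eq_or_lt with h2 | h2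
    · rw [← h2, Real.cos_zero, mul_one] at hr
      linarith [Real.exp_pos w.re]
    · exact (mul_pos (Real.exp_pos w.re) (Real.sin_pos_of_pos_of_lt_pi h2 h1)).ne' hi
  have hexp_im : ∀ w : ℂ, 0 < w.im → w.im < Real.pi → 0 < (Complex.exp w).im := by
    intro w h0 h1
    rw [Complex.exp_im]
    exact mul_pos (Real.exp_pos w.re) (Real.sin_pos_of_pos_of_lt_pi h0 h1)
  have hp_im : ∀ w : ℂ, 0 < w.im → w.im < Real.pi → 0 < (p w).im := by
    intro w h0 h1
    have h2 : 0 < Complex.normSq (Complex.exp w + 1) :=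
      Complex.normSq_pos.2 (hpos w h0.le h1)
    have h3 : (p w).im = 2 * (Complex.exp w).im / Complex.normSq (Complex.exp w + 1) := by
      rw [hp, Complex.div_im]
      simp only [Complex.sub_im, Complex.one_im, Complex.add_re, Complex.one_re, Complex.sub_re,
        Complex.add_im]
      ring
    rw [h3]
    have := hexp_im w h0 h1
    positivity
  have hp_re : ∀ w : ℂ, w.im = 0 → ∃ x ∈ Set.Ioo (-1 : ℝ) 1, p w = (x : ℂ) := by
    intro w h
    have e : w = (w.re : ℂ) := Complex.ext (by simp) (by simp [h])
    have h1 := Real.exp_pos w.re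
    refine ⟨(Real.exp w.re - 1) / (Real.exp w.re + 1), ⟨?_, ?_⟩, ?_⟩
    · rw [lt_div_iff₀ (by linarith)]; linarith
    · rw [div_lt_iff₀ (by linarith)]; linarith
    · rw [hp, e]; simp
  have hp_mem : ∀ w : ℂ, 0 ≤ w.im → w.im < Real.pi → p w ∈ cutPlane := by
    intro w h0 h1
    rcases h0.eq_or_lt with h | h
    · obtain ⟨x, hx, hxe⟩ := hp_re w h.symm
      rw [hxe]; exact ofReal_mem_cutPlane.2 hx
    · exact mem_cutPlane_of_im_ne_zero (hp_im w h h1).ne'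
  -- The logarithm of `(1 + z) / (1 - z)` is the strip coordinate of `z`.
  have hz1 : 1 + z ≠ 0 := one_add_ne_zero_of_mem_cutPlane (mem_cutPlane_of_im_ne_zero hz.ne')
  have hz2 : 1 - z ≠ 0 := one_sub_ne_zero_of_mem_cutPlane (mem_cutPlane_of_im_ne_zero hz.ne')
  set s : ℂ := (1 + z) / (1 - z) with hs
  have hs0 : s ≠ 0 := div_ne_zero hz1 hz2
  have hs_im : 0 < s.im := by
    have h2 : 0 < Complex.normSq (1 - z) := Complex.normSq_pos.2 hz2
    have h3 : s.im = 2 * z.im / Complex.normSq (1 - z) := by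
      rw [hs, Complex.div_im]
      simp only [Complex.sub_im, Complex.one_im, Complex.add_re, Complex.one_re, Complex.sub_re,
        Complex.add_im]
      ring
    rw [h3]; positivity
  set w := Complex.log s with hwdef
  have hexp : Complex.exp w = s := Complex.exp_log hs0
  have hw0 : 0 < w.im := by
    rw [hwdef, Complex.log_im]
    refine (Complex.arg_nonneg_iff.2 hs_im.le).lt_of_ne fun h => ?_
    exact hs_im.ne' (Complex.arg_eq_zero_iff.1 h.symm).2
  have hwpi : w.im < Real.pi := by
    rw [hwdef, Complex.log_im]
    refine (Complex.arg_le_pi s).lt_of_ne fun h => ?_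
    exact hs_im.ne' (Complex.arg_eq_pi_iff.1 h).2
  have hpw : p w = z := by
    have h2 : s + 1 ≠ 0 := by
      have h3 := hpos w hw0.le hwpi
      rwa [hexp] at h3
    rw [hp]
    simp only [hexp]
    rw [div_eq_iff h2, hs]
    field_simp
    ring
  have hinv : (1 - z) / (1 + z) = Complex.exp (-w) := by
    rw [Complex.exp_neg, hexp, hs, inv_div]
  -- Adding `exp` makes the values nonzero on the strip; after multiplication by `exp (-w)` it
  -- contributes only the real number `1`.
  have key : ((a z + s) * Complex.exp (-w)).im ≤ 0 := by
    have hg : ∀ v : ℂ, 0 < v.im → v.im < Real.pi → 0 < (a (p v) + Complex.exp v).im := by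
      intro v h0 h1
      rw [Complex.add_im]
      have := him _ (hp_im v h0 h1)
      have := hexp_im v h0 h1
      linarith
    have h := arg_le_im_of_strip (g := fun v => a (p v) + Complex.exp v) ?_ hg ?_ hw0 hwpi
    · rw [hpw, hexp] at h
      have h2 := hg w hw0 hwpi
      rw [hpw, hexp] at h2
      exact im_mul_exp_neg_nonpos h2.le hwpi.le h
    · intro v h0 h1
      have h2 : DifferentiableAt ℂ p v :=
        (Complex.differentiableAt_exp.sub_const 1).div
          (Complex.differentiableAt_exp.add_const 1) (hpos v h0 h1)
      have h3 : DifferentiableAt ℂ a (p v) :=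
        hd.differentiableAt (isOpen_cutPlane.mem_nhds (hp_mem v h0 h1))
      exact (h3.comp v h2).add Complex.differentiableAt_exp
    · intro v hv
      obtain ⟨x, hx, hxe⟩ := hp_re v hv
      have h1 := hre x hx
      rw [hxe, Complex.add_re, Complex.add_im,
        Complex.exp_im, Complex.exp_re, hv, h1.2, Real.sin_zero, Real.cos_zero]
      exact ⟨by have := Real.exp_pos v.re; linarith [h1.1], by simp⟩
  have hse : s * Complex.exp (-w) = 1 := by
    rw [Complex.exp_neg, hexp, mul_inv_cancel₀ hs0]
  rw [add_mul, hse] at key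
  rw [hinv]
  simpa using key

/-! ### The Nevanlinna kernel -/

/-- Cauchy's formula, with the second denominator written so that the integrand is a positive
multiple of `φ` when `ζ = ω`. On the circle, `u * conj (u - ω) = R ^ 2 - conj ω * u`. -/
theorem circleAverage_div_sub_mul_conj_sub {φ : ℂ → ℂ}
    (hφ : DifferentiableOn ℂ φ (Metric.ball 0 1)) {R : ℝ} (hR0 : 0 < R) (hR : R < 1) {ζ ω : ℂ}
    (hζ : ‖ζ‖ < R) (hω : ‖ω‖ < R) :
    Real.circleAverage (fun u => φ u / ((u - ζ) * starRingEnd ℂ (u - ω))) 0 R =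
      φ ζ / (R ^ 2 - starRingEnd ℂ ω * ζ) := by
  have hden : ∀ u ∈ Metric.closedBall (0 : ℂ) R, (R : ℂ) ^ 2 - starRingEnd ℂ ω * u ≠ 0 := by
    intro u hu h
    have h1 : ‖(R : ℂ) ^ 2‖ = ‖starRingEnd ℂ ω * u‖ := by rw [sub_eq_zero.1 h]
    rw [norm_mul, RCLike.norm_conj, norm_pow, Complex.norm_real, Real.norm_of_nonneg hR0.le] at h1
    have h2 : ‖u‖ ≤ R := by simpa using hu
    nlinarith [norm_nonneg ω, norm_nonneg u]
  have hd : DifferentiableOn ℂ (fun u => φ u / ((R : ℂ) ^ 2 - starRingEnd ℂ ω * u))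
      (Metric.closedBall 0 R) :=
    (hφ.mono (Metric.closedBall_subset_ball hR)).div (by fun_prop) hden
  have hc := (hd.diffContOnCl_ball subset_rfl).circleIntegral_sub_inv_smul
    (w := ζ) (by simpa using hζ)
  rw [Real.circleAverage_eq_circleIntegral hR0.ne', circleIntegral.integral_congr hR0.le
    (g := fun u => (u - ζ)⁻¹ • (φ u / ((R : ℂ) ^ 2 - starRingEnd ℂ ω * u))) ?_, hc, smul_smul,
    inv_mul_cancel₀ Complex.two_pi_I_ne_zero, one_smul]
  intro u hu
  have hun : ‖u‖ = R := by simpa using hu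
  have hu0 : u ≠ 0 := norm_pos_iff.1 (hun ▸ hR0)
  have h1 : u * starRingEnd ℂ (u - ω) = (R : ℂ) ^ 2 - starRingEnd ℂ ω * u := by
    rw [map_sub, mul_sub, Complex.mul_conj, Complex.normSq_eq_norm_sq, hun]
    push_cast
    ring
  simp only [sub_zero, smul_eq_mul]
  rw [← h1]
  simp only [div_eq_mul_inv, mul_inv]
  ring

section

variable {M : Type*} [NormedAddCommGroup M] [InnerProductSpace ℂ M]

/-- The Schwarz-Pick form of a function with nonnegative real part in the disc, on a smaller disc
of radius `R`: it is the mean over the circle of the forms `Re (G h, h)`, where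
`h u = ∑ k, (u - ζ k)⁻¹ • f k`. -/
theorem re_sum_inner_div_nonneg_of_radius {G : ℂ → M →L[ℂ] M}
    (hG : DifferentiableOn ℂ G (Metric.ball 0 1))
    (hre : ∀ u ∈ Metric.ball (0 : ℂ) 1, ∀ f, 0 ≤ (inner ℂ f (G u f)).re)
    {R : ℝ} (hR0 : 0 < R) (hR : R < 1) {n : ℕ} (ζ : Fin n → ℂ) (hζ : ∀ k, ‖ζ k‖ < R)
    (f : Fin n → M) :
    0 ≤ (∑ k, ∑ m, inner ℂ (f m) (G (ζ k) (f k)) /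
      ((R : ℂ) ^ 2 - starRingEnd ℂ (ζ m) * ζ k)).re := by
  have hφ : ∀ k m, DifferentiableOn ℂ (fun u => inner ℂ (f m) (G u (f k))) (Metric.ball 0 1) := by
    intro k m
    exact (innerSL ℂ (f m)).differentiable.comp_differentiableOn
      (hG.clm_apply (differentiableOn_const _))
  have hne : ∀ u ∈ Metric.sphere (0 : ℂ) R, ∀ k, u - ζ k ≠ 0 := by
    intro u hu k h
    have h1 : ‖u‖ = R := by simpa using hu
    rw [sub_eq_zero.1 h] at h1
    exact (hζ k).ne h1
  have hint : ∀ k m, CircleIntegrable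
      (fun u => inner ℂ (f m) (G u (f k)) / ((u - ζ k) * starRingEnd ℂ (u - ζ m))) 0 R := by
    intro k m
    refine ContinuousOn.circleIntegrable hR0.le ?_
    refine ((hφ k m).continuousOn.mono ?_).div ?_ ?_
    · exact Metric.sphere_subset_closedBall.trans (Metric.closedBall_subset_ball hR)
    · exact ((continuous_id.sub continuous_const).mul
        (Complex.continuous_conj.comp (continuous_id.sub continuous_const))).continuousOn
    · intro u hu
      exact mul_ne_zero (hne u hu k) ((map_ne_zero _).2 (hne u hu m))
  have hsum : ∑ k, ∑ m, inner ℂ (f m) (G (ζ k) (f k)) /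
      ((R : ℂ) ^ 2 - starRingEnd ℂ (ζ m) * ζ k) =
      Real.circleAverage (fun u => ∑ k, ∑ m, inner ℂ (f m) (G u (f k)) /
        ((u - ζ k) * starRingEnd ℂ (u - ζ m))) 0 R := by
    rw [Real.circleAverage_fun_sum fun k _ => CircleIntegrable.fun_sum _ fun m _ => hint k m]
    refine Finset.sum_congr rfl fun k _ => ?_
    rw [Real.circleAverage_fun_sum fun m _ => hint k m]
    exact Finset.sum_congr rfl fun m _ =>
      (circleAverage_div_sub_mul_conj_sub (hφ k m) hR0 hR (hζ k) (hζ m)).symm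
  have hre' := Complex.reCLM.circleAverage_comp_comm
    (CircleIntegrable.fun_sum Finset.univ fun k _ =>
      CircleIntegrable.fun_sum Finset.univ fun m _ => hint k m)
  rw [hsum, ← Complex.reCLM_apply, ← hre']
  refine Real.circleAverage_nonneg_of_nonneg fun u hu => ?_
  rw [abs_of_pos hR0] at hu
  have hform : ∑ k, ∑ m, inner ℂ (f m) (G u (f k)) / ((u - ζ k) * starRingEnd ℂ (u - ζ m)) =
      inner ℂ (∑ m, (u - ζ m)⁻¹ • f m) (G u (∑ k, (u - ζ k)⁻¹ • f k)) := by
    rw [map_sum, inner_sum]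
    refine Finset.sum_congr rfl fun k _ => ?_
    rw [sum_inner]
    refine Finset.sum_congr rfl fun m _ => ?_
    rw [map_smul, inner_smul_left, inner_smul_right, map_inv₀]
    simp only [div_eq_mul_inv, mul_inv]
    ring
  simp only [Function.comp_apply, Complex.reCLM_apply]
  rw [hform]
  exact hre u (Metric.sphere_subset_closedBall.trans (Metric.closedBall_subset_ball hR) hu) _

theorem re_sum_inner_div_nonneg {G : ℂ → M →L[ℂ] M}
    (hG : DifferentiableOn ℂ G (Metric.ball 0 1))
    (hre : ∀ u ∈ Metric.ball (0 : ℂ) 1, ∀ f, 0 ≤ (inner ℂ f (G u f)).re)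
    {n : ℕ} (ζ : Fin n → ℂ) (hζ : ∀ k, ‖ζ k‖ < 1) (f : Fin n → M) :
    0 ≤ (∑ k, ∑ m, inner ℂ (f m) (G (ζ k) (f k)) / (1 - starRingEnd ℂ (ζ m) * ζ k)).re := by
  have hcont : ContinuousAt (fun R : ℝ => (∑ k, ∑ m, inner ℂ (f m) (G (ζ k) (f k)) /
      ((R : ℂ) ^ 2 - starRingEnd ℂ (ζ m) * ζ k)).re) 1 := by
    refine Complex.continuous_re.continuousAt.comp ?_
    refine tendsto_finsetSum _ fun k _ => tendsto_finsetSum _ fun m _ => ?_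
    refine ContinuousAt.div (by fun_prop) (by fun_prop) ?_
    intro h
    have h1 : ‖(1 : ℂ)‖ = ‖starRingEnd ℂ (ζ m) * ζ k‖ := by
      rw [← sub_eq_zero.1 h]; simp
    rw [norm_mul, RCLike.norm_conj, norm_one] at h1
    nlinarith [norm_nonneg (ζ m), norm_nonneg (ζ k), hζ m, hζ k]
  have hlim := hcont.tendsto.mono_left (nhdsWithin_le_nhds (s := Set.Iio 1))
  simp only [Complex.ofReal_one, one_pow] at hlim
  refine ge_of_tendsto hlim ?_
  have h1 : ∀ k, ∀ᶠ R in nhdsWithin (1 : ℝ) (Set.Iio 1), ‖ζ k‖ < R := fun k =>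
    nhdsWithin_le_nhds (lt_mem_nhds (hζ k))
  filter_upwards [Filter.eventually_all.2 h1, Ioo_mem_nhdsLT (zero_lt_one' ℝ)] with R hR hR1
  exact re_sum_inner_div_nonneg_of_radius hG hre hR1.1 hR1.2 ζ hR f

theorem IsNonnegKernelOn.comp {K : ℂ → ℂ → M →L[ℂ] M} {D D' : Set ℂ} (hK : IsNonnegKernelOn K D)
    {τ : ℂ → ℂ} (hτ : ∀ z ∈ D', τ z ∈ D) : IsNonnegKernelOn (fun z w => K (τ z) (τ w)) D' :=
  fun n z f hz => hK n (fun k => τ (z k)) f fun k => hτ _ (hz k)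

theorem IsNonnegKernelOn.congr {K K' : ℂ → ℂ → M →L[ℂ] M} {D : Set ℂ} (hK : IsNonnegKernelOn K D)
    (h : ∀ z ∈ D, ∀ w ∈ D, K' z w = K z w) : IsNonnegKernelOn K' D := by
  intro n z f hz
  simp only [h _ (hz _) _ (hz _)]
  exact hK n z f hz

variable [CompleteSpace M]

open scoped ComplexOrder in
/-- The kernel `(F z - (F w)*) / (z - conj w)` of a Nevanlinna function is nonnegative on the upper
half-plane. -/
theorem IsNevanlinna.kernel_nonneg_upper {F : ℂ → M →L[ℂ] M} (hF : IsNevanlinna F) :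
    IsNonnegKernelOn (fun z w => (z - starRingEnd ℂ w)⁻¹ • (F z - star (F w)))
      {z : ℂ | 0 < z.im} := by
  intro n z f hz
  -- The Cayley transform carries the upper half-plane to the unit disc.
  set u : Fin n → ℂ := fun k => (z k - Complex.I) / (z k + Complex.I) with hu
  set C : ℂ → ℂ := fun v => Complex.I * (1 + v) / (1 - v) with hC
  set G : ℂ → M →L[ℂ] M := fun v => (-Complex.I) • F (C v) with hG
  have hzI : ∀ k, z k + Complex.I ≠ 0 := by
    intro k h
    have h1 := congrArg Complex.im h
    have h2 := hz k
    simp only [Complex.add_im, Complex.I_im, Complex.zero_im, Set.mem_ofPred_eq] at h1 h2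
    linarith
  have hu1 : ∀ k, 1 - u k = 2 * Complex.I / (z k + Complex.I) := by
    intro k
    rw [eq_div_iff (hzI k), hu, sub_mul, div_mul_cancel₀ _ (hzI k)]
    ring
  have hCu : ∀ k, C (u k) = z k := by
    intro k
    have h2 : 1 - u k ≠ 0 := by
      rw [hu1]; exact div_ne_zero (by simp) (hzI k)
    rw [hC, div_eq_iff h2, hu1, hu, mul_div_assoc', eq_div_iff (hzI k), mul_assoc, add_mul,
      div_mul_cancel₀ _ (hzI k)]
    ring
  have hball : ∀ v ∈ Metric.ball (0 : ℂ) 1, 1 - v ≠ 0 := by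
    intro v hv h
    rw [← sub_eq_zero.1 h] at hv
    simp at hv
  have hCim : ∀ v ∈ Metric.ball (0 : ℂ) 1, 0 < (C v).im := by
    intro v hv
    have h1 : 0 < Complex.normSq (1 - v) := Complex.normSq_pos.2 (hball v hv)
    have h2 : (C v).im = (1 - Complex.normSq v) / Complex.normSq (1 - v) := by
      rw [hC, Complex.div_im, Complex.normSq_apply v]
      simp
      ring
    rw [h2]
    refine div_pos ?_ h1
    rw [Complex.normSq_eq_norm_sq]
    have h3 : ‖v‖ < 1 := by simpa using hv
    nlinarith [norm_nonneg v]
  have hunorm : ∀ k, ‖u k‖ < 1 := by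
    intro k
    rw [hu, norm_div, div_lt_one (norm_pos_iff.2 (hzI k)), ← sq_lt_sq₀ (norm_nonneg _)
      (norm_nonneg _), ← Complex.normSq_eq_norm_sq, ← Complex.normSq_eq_norm_sq,
      Complex.normSq_apply, Complex.normSq_apply]
    have h2 : 0 < (z k).im := hz k
    simp
    nlinarith
  have hCd : DifferentiableOn ℂ C (Metric.ball 0 1) :=
    DifferentiableOn.div (by fun_prop) (by fun_prop) hball
  have hGd : DifferentiableOn ℂ G (Metric.ball 0 1) :=
    (hF.holo.comp hCd fun v hv => (hCim v hv).ne').const_smul (-Complex.I)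
  have hGre : ∀ v ∈ Metric.ball (0 : ℂ) 1, ∀ g, 0 ≤ (inner ℂ g (G v g)).re := by
    intro v hv g
    have h1 := hF.mul_im_inner_nonneg (hCim v hv).ne' g
    have h2 := nonneg_of_mul_nonneg_right h1 (hCim v hv)
    rw [hG, smul_apply, inner_smul_right]
    simpa using h2
  have hS := re_sum_inner_div_nonneg hGd hGre u hunorm fun k => (1 - u k) • f k
  set Q : Fin n → Fin n → ℂ := fun k m =>
    inner ℂ ((1 - u m) • f m) (G (u k) ((1 - u k) • f k)) /
      (1 - starRingEnd ℂ (u m) * u k) with hQ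
  -- Each term of the kernel sum is the Hermitian part of a disc term, with `f k` rescaled by
  -- `1 - u k`.
  have hterm : ∀ k m, inner ℂ (f m) (((z k - starRingEnd ℂ (z m))⁻¹ •
      (F (z k) - star (F (z m)))) (f k)) = (Q k m + starRingEnd ℂ (Q m k)) / 2 := by
    intro k m
    have h1 : ∀ k m, Q k m = (z k - starRingEnd ℂ (z m))⁻¹ * 2 * inner ℂ (f m) (F (z k) (f k)) := by
      intro k m
      have hzk := hzI k
      have hzm := (map_ne_zero (starRingEnd ℂ)).2 (hzI m)
      rw [map_add, Complex.conj_I] at hzm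
      have hd : z k - starRingEnd ℂ (z m) ≠ 0 := by
        intro h
        have h3 := congrArg Complex.im h
        have h4 : 0 < (z k).im := hz k
        have h5 : 0 < (z m).im := hz m
        simp at h3
        linarith
      have h6 : 1 - starRingEnd ℂ (u m) * u k = -2 * Complex.I * (z k - starRingEnd ℂ (z m)) /
          ((starRingEnd ℂ (z m) + -Complex.I) * (z k + Complex.I)) := by
        rw [hu]
        simp only [map_div₀, map_sub, map_add, Complex.conj_I]
        field_simp
        ring
      simp only [hQ, hG, hCu]
      rw [h6, hu1, hu1, map_smul, inner_smul_left, inner_smul_right, smul_apply, inner_smul_right]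
      simp only [map_div₀, map_mul, map_add, Complex.conj_I, map_ofNat]
      have hI := Complex.I_ne_zero
      field_simp
      linear_combination (-1 : ℂ) * inner ℂ (f m) ((F (z k)) (f k)) * Complex.I_sq
    have h2 : inner ℂ (f m) (star (F (z m)) (f k)) =
        starRingEnd ℂ (inner ℂ (f k) (F (z m) (f m))) := by
      rw [ContinuousLinearMap.star_eq_adjoint, ContinuousLinearMap.adjoint_inner_right,
        inner_conj_symm]
    have h3 : (starRingEnd ℂ (z m) - z k)⁻¹ = -(z k - starRingEnd ℂ (z m))⁻¹ := by
      rw [← inv_neg, neg_sub]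
    rw [h1, h1, smul_apply, inner_smul_right, sub_apply, inner_sub_right, h2]
    simp only [map_mul, map_inv₀, map_sub, Complex.conj_conj, map_ofNat]
    rw [h3]
    ring
  simp only [hterm]
  have hswap : ∑ k, ∑ m, starRingEnd ℂ (Q m k) = starRingEnd ℂ (∑ k, ∑ m, Q k m) := by
    rw [Finset.sum_comm]; simp only [map_sum]
  have htot : ∑ k, ∑ m, (Q k m + starRingEnd ℂ (Q m k)) / 2 =
      (((∑ k, ∑ m, Q k m).re : ℝ) : ℂ) := by
    simp only [← Finset.sum_div, Finset.sum_add_distrib]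
    rw [hswap, Complex.add_conj]
    push_cast
    ring
  rw [htot]
  exact Complex.zero_le_real.2 hS

theorem IsNonnegKernelOn.conj_mul {K : ℂ → ℂ → M →L[ℂ] M} {D : Set ℂ} (hK : IsNonnegKernelOn K D)
    (B : ℂ → M →L[ℂ] M) : IsNonnegKernelOn (fun z w => star (B w) * K z w * B z) D := by
  intro n z f hz
  have h := hK n z (fun k => B (z k) (f k)) hz
  simpa only [mul_apply_eq_comp, ContinuousLinearMap.star_eq_adjoint,
    ContinuousLinearMap.adjoint_inner_right] using h

theorem IsNevanlinna.kernel_nonneg_lower {F : ℂ → M →L[ℂ] M} (hF : IsNevanlinna F) :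
    IsNonnegKernelOn (fun z w => (z - starRingEnd ℂ w)⁻¹ • (F z - star (F w)))
      {z : ℂ | z.im < 0} := by
  refine (hF.neg_comp_neg.kernel_nonneg_upper.comp (τ := fun z => -z) (D' := {z : ℂ | z.im < 0})
    fun z hz => by simpa using hz).congr fun z _ w _ => ?_
  simp only [neg_neg, map_neg, star_neg]
  rw [show -z - -starRingEnd ℂ w = -(z - starRingEnd ℂ w) by ring, inv_neg, neg_smul, ← smul_neg]
  congr 1
  abel

end

section

variable {M : Type*} [NormedAddCommGroup M] [InnerProductSpace ℂ M]

/-! ### Cayley-type transforms and their quadratic forms -/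

theorem inner_self_eq_ofReal_norm_sq (f : M) : inner ℂ f f = ((‖f‖ ^ 2 : ℝ) : ℂ) := by
  rw [inner_self_eq_norm_sq_to_K]; norm_cast

theorem inner_add_apply_sub_apply (T : M →L[ℂ] M) (h : M) :
    inner ℂ (h + T h) (h - T h) =
      ((‖h‖ ^ 2 - ‖T h‖ ^ 2 : ℝ) : ℂ) - ((2 * (inner ℂ h (T h)).im : ℝ) : ℂ) * Complex.I := by
  rw [inner_add_left, inner_sub_right, inner_sub_right, inner_self_eq_ofReal_norm_sq,
    inner_self_eq_ofReal_norm_sq, ← inner_conj_symm (T h) h, ← Complex.sub_conj]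
  push_cast
  ring

/-- The inverse Cayley transform `2 (1 + T)⁻¹ - 1 = (1 - T) (1 + T)⁻¹`, at `f = (1 + T) h`. -/
theorem two_smul_inverse_sub_one_apply {T : M →L[ℂ] M} (hT : IsUnit (1 + T)) (h : M) :
    ((2 : ℂ) • Ring.inverse (1 + T) - 1) (h + T h) = h - T h := by
  have h1 : Ring.inverse (1 + T) (h + T h) = h := by
    have := DFunLike.congr_fun (Ring.inverse_mul_cancel _ hT) h
    simpa only [mul_apply_eq_comp, add_apply, one_apply_eq_self] using this
  rw [sub_apply, smul_apply, h1, one_apply_eq_self, two_smul]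
  abel

theorem exists_eq_add_apply {T : M →L[ℂ] M} (hT : IsUnit (1 + T)) (f : M) :
    ∃ h, h + T h = f := by
  refine ⟨Ring.inverse (1 + T) f, ?_⟩
  have := DFunLike.congr_fun (Ring.mul_inverse_cancel _ hT) f
  simpa only [mul_apply_eq_comp, add_apply, one_apply_eq_self] using this

theorem inner_sub_smul_smul_sub_im (T : M →L[ℂ] M) (z : ℂ) (f : M) :
    (inner ℂ (f - z • T f) (z • f - T f)).im =
      z.im * (‖f‖ ^ 2 - ‖T f‖ ^ 2) - (1 - ‖z‖ ^ 2) * (inner ℂ f (T f)).im := by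
  rw [inner_sub_left, inner_sub_right, inner_sub_right, inner_smul_left, inner_smul_left,
    inner_smul_right, inner_smul_right, inner_self_eq_ofReal_norm_sq,
    inner_self_eq_ofReal_norm_sq, ← inner_conj_symm (T f) f, ← Complex.normSq_eq_norm_sq,
    Complex.normSq_apply]
  simp only [Complex.sub_im, Complex.mul_im, Complex.mul_re, Complex.conj_re, Complex.conj_im,
    Complex.ofReal_re, Complex.ofReal_im]
  ring

theorem norm_smul_sub_le_norm_sub_smul {T : M →L[ℂ] M} {f : M} {x : ℝ} (hx : |x| ≤ 1)
    (h : ‖T f‖ ≤ ‖f‖) : ‖(x : ℂ) • f - T f‖ ≤ ‖f - (x : ℂ) • T f‖ := by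
  refine le_of_sq_le_sq ?_ (norm_nonneg _)
  rw [norm_sub_sq (𝕜 := ℂ), norm_sub_sq (𝕜 := ℂ), inner_smul_left, inner_smul_right, norm_smul,
    norm_smul, Complex.conj_ofReal, Complex.norm_real, Real.norm_eq_abs, mul_pow, mul_pow]
  have h1 : |x| ^ 2 ≤ 1 := pow_le_one₀ (abs_nonneg _) hx
  have h2 : ‖T f‖ ^ 2 ≤ ‖f‖ ^ 2 := by gcongr
  nlinarith

/-- The convex combination of a function with the identity function `z ↦ z I`, whose imaginary part
is strictly positive. -/
noncomputable def mixId (r : ℝ) (F : ℂ → M →L[ℂ] M) (z : ℂ) : M →L[ℂ] M :=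
  (r : ℂ) • F z + (((1 - r : ℝ) : ℂ) * z) • 1

theorem inner_mixId (r : ℝ) (F : ℂ → M →L[ℂ] M) (z : ℂ) (f : M) :
    inner ℂ f (mixId r F z f) =
      (r : ℂ) * inner ℂ f (F z f) + ((1 - r : ℝ) : ℂ) * (((‖f‖ ^ 2 : ℝ) : ℂ) * z) := by
  rw [mixId, add_apply, inner_add_right, smul_apply, smul_apply, inner_smul_right,
    inner_smul_right, one_apply_eq_self, inner_self_eq_ofReal_norm_sq]
  ring

theorem rsTransform_mul {F : ℂ → M →L[ℂ] M} {z : ℂ} (hz : IsUnit (1 - z • F z)) :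
    rsTransform F z * (1 - z • F z) = z • 1 - F z := by
  rw [rsTransform, mul_assoc, Ring.inverse_mul_cancel _ hz, mul_one]

/-- Every vector is `(1 - z F z) f` for some `f`, and `Υ z` maps it to `(z - F z) f`. -/
theorem exists_rsTransform_apply {F : ℂ → M →L[ℂ] M} {z : ℂ} (hz : IsUnit (1 - z • F z)) (g : M) :
    ∃ f, g = f - z • F z f ∧ rsTransform F z g = z • f - F z f := by
  have h1 := DFunLike.congr_fun (Ring.mul_inverse_cancel _ hz) g
  simp only [mul_apply_eq_comp, sub_apply, one_apply_eq_self, smul_apply] at h1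
  refine ⟨Ring.inverse (1 - z • F z) g, h1.symm, ?_⟩
  rw [rsTransform, mul_apply_eq_comp, sub_apply, smul_apply, one_apply_eq_self]

variable [CompleteSpace M]

/-! ### The operator Schwarz-Pick inequality -/

theorem IsRS.norm_apply_le {F : ℂ → M →L[ℂ] M} (hF : IsRS F) {x : ℝ}
    (hx : x ∈ Set.Ioo (-1 : ℝ) 1) (f : M) : ‖F x f‖ ≤ ‖f‖ :=
  norm_apply_le_of_bounds (hF.bounds x hx) f

/-- The Schwarz-Pick inequality in the lower half-plane when `1 + F` is invertible. The function
`v ↦ ((2 (1 + F (-v))⁻¹ - 1) f, f)` satisfies the hypotheses of the angular bound, and at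
`f = (1 + F z) h` the bound reads as the inequality for `h`. -/
theorem IsRS.schwarz_pick_lower_of_isUnit {F : ℂ → M →L[ℂ] M} (hF : IsRS F)
    (hU : ∀ z ∈ cutPlane, IsUnit (1 + F z)) {z : ℂ} (hz : z.im < 0) (h : M) :
    0 ≤ ‖h‖ ^ 2 - ‖F z h‖ ^ 2 - (1 - ‖z‖ ^ 2) / z.im * (inner ℂ h (F z h)).im := by
  set f := h + F z h with hf
  have hval : ∀ v ∈ cutPlane, ∃ g, inner ℂ f (((2 : ℂ) • Ring.inverse (1 + F (-v)) - 1) f) =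
      ((‖g‖ ^ 2 - ‖F (-v) g‖ ^ 2 : ℝ) : ℂ) -
        ((2 * (inner ℂ g (F (-v) g)).im : ℝ) : ℂ) * Complex.I := by
    intro v hv
    have hv' := hU _ (neg_mem_cutPlane hv)
    obtain ⟨g, hg⟩ := exists_eq_add_apply hv' f
    refine ⟨g, ?_⟩
    rw [← inner_add_apply_sub_apply, ← hg, two_smul_inverse_sub_one_apply hv']
  have key := im_div_nonpos_of_nonneg_on_interval
    (a := fun v => inner ℂ f (((2 : ℂ) • Ring.inverse (1 + F (-v)) - 1) f)) ?_ ?_ ?_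
    (z := -z) (by simpa using hz)
  · have hz' : z ∈ cutPlane := mem_cutPlane_of_im_ne_zero hz.ne
    simp only [neg_neg] at key
    rw [hf, two_smul_inverse_sub_one_apply (hU z hz'), inner_add_apply_sub_apply] at key
    have hN : 0 < Complex.normSq (1 + -z) := by
      rw [← sub_eq_add_neg]
      exact Complex.normSq_pos.2 (one_sub_ne_zero_of_mem_cutPlane hz')
    have hdiv : (1 - -z) / (1 + -z) = ((Complex.normSq (1 + -z))⁻¹ : ℝ) *
        (((1 - ‖z‖ ^ 2 : ℝ) : ℂ) + ((2 * z.im : ℝ) : ℂ) * Complex.I) := by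
      have : (((1 - ‖z‖ ^ 2 : ℝ) : ℂ) + ((2 * z.im : ℝ) : ℂ) * Complex.I) =
          (1 - -z) * starRingEnd ℂ (1 + -z) := by
        rw [← Complex.sub_conj, ← Complex.normSq_eq_norm_sq]
        push_cast
        rw [Complex.normSq_eq_conj_mul_self]
        simp
        ring
      rw [this, div_eq_mul_inv, Complex.inv_def]
      push_cast
      ring
    rw [hdiv, mul_left_comm, Complex.im_ofReal_mul] at key
    have key2 := nonpos_of_mul_nonpos_right key (inv_pos.2 hN)
    simp only [Complex.mul_im, Complex.sub_re, Complex.sub_im, Complex.add_re, Complex.add_im,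
      Complex.ofReal_re, Complex.ofReal_im, Complex.mul_re, Complex.I_re, Complex.I_im] at key2
    have e : ‖h‖ ^ 2 - ‖F z h‖ ^ 2 - (1 - ‖z‖ ^ 2) / z.im * (inner ℂ h (F z h)).im =
        ((‖h‖ ^ 2 - ‖F z h‖ ^ 2) * z.im - (1 - ‖z‖ ^ 2) * (inner ℂ h (F z h)).im) / z.im := by
      field_simp [hz.ne]
    rw [e]
    exact div_nonneg_of_nonpos (by linarith) hz.le
  · have h1 : DifferentiableOn ℂ (fun v => 1 + F (-v)) cutPlane :=
      (hF.nevanlinna.holo.comp (differentiableOn_neg _) fun _ hv => neg_mem_cutPlane hv).const_add 1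
    have h2 : DifferentiableOn ℂ (fun v => Ring.inverse (1 + F (-v))) cutPlane :=
      h1.inverse fun v hv => hU _ (neg_mem_cutPlane hv)
    exact (innerSL ℂ f).differentiable.comp_differentiableOn
      (((h2.const_smul (2 : ℂ)).sub_const 1).clm_apply (differentiableOn_const _))
  · intro v hv
    obtain ⟨g, hg⟩ := hval v (mem_cutPlane_of_im_ne_zero hv.ne')
    have h1 := hF.nevanlinna.nevanlinna.mul_im_inner_nonneg (z := -v)
      (by simpa using hv.ne') g
    rw [Complex.neg_im] at h1
    have h2 : (inner ℂ g (F (-v) g)).im ≤ 0 := by nlinarith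
    simp only [hg]
    rw [Complex.sub_im, Complex.ofReal_im, Complex.im_ofReal_mul, Complex.I_im]
    linarith
  · intro x hx
    obtain ⟨g, hg⟩ := hval x (ofReal_mem_cutPlane.2 hx)
    have hx' : -x ∈ Set.Ioo (-1 : ℝ) 1 := ⟨by linarith [hx.2], by linarith [hx.1]⟩
    have h1 := hF.norm_apply_le hx' g
    have h2 := hF.nevanlinna.inner_ofReal_im hx' g
    simp only [hg]
    rw [← Complex.ofReal_neg, h2, mul_zero, Complex.ofReal_zero, zero_mul, sub_zero]
    refine ⟨?_, Complex.ofReal_im _⟩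
    rw [Complex.ofReal_re]
    nlinarith [norm_nonneg (F ((-x : ℝ) : ℂ) g)]

theorem IsRS.isRS_mixId {F : ℂ → M →L[ℂ] M} (hF : IsRS F) {r : ℝ} (h0 : 0 ≤ r) (h1 : r ≤ 1) :
    IsRS (mixId r F) := by
  have hh : ∀ s, DifferentiableOn ℂ F s → DifferentiableOn ℂ (mixId r F) s := fun s hs =>
    (hs.const_smul (r : ℂ)).add ((differentiableOn_id.const_mul _).smul_const 1)
  have hN : IsNevanlinnaOnCutPlane (mixId r F) :=
    { nevanlinna :=
        { holo := hh _ hF.nevanlinna.nevanlinna.holo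
          symm := fun z hz => by
            simp [mixId, star_add, star_smul, hF.nevanlinna.nevanlinna.symm z hz]
          im_nonneg := fun z hz => by
            rw [im_smul_nonneg_iff]
            intro f
            rw [inner_mixId, Complex.add_im, Complex.im_ofReal_mul, Complex.im_ofReal_mul,
              Complex.im_ofReal_mul]
            have h2 := mul_nonneg h0 (hF.nevanlinna.nevanlinna.mul_im_inner_nonneg hz f)
            have h3 : 0 ≤ (1 - r) * (‖f‖ ^ 2 * (z.im * z.im)) :=
              mul_nonneg (by linarith) (mul_nonneg (sq_nonneg _) (mul_self_nonneg _))
            linarith }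
      holo := hh _ hF.nevanlinna.holo }
  rw [hN.isRS_iff]
  intro x hx f
  have h2 := abs_le.1 (hF.nevanlinna.isRS_iff.1 hF x hx f)
  rw [inner_mixId, Complex.add_re, Complex.re_ofReal_mul, Complex.re_ofReal_mul,
    Complex.re_ofReal_mul, Complex.ofReal_re, abs_le]
  have h3 := sq_nonneg ‖f‖
  have h4 : 0 ≤ 1 - r := by linarith
  have h5 : ‖f‖ ^ 2 * x ≤ ‖f‖ ^ 2 := mul_le_of_le_one_right h3 hx.2.le
  have h6 : -‖f‖ ^ 2 ≤ ‖f‖ ^ 2 * x := by nlinarith [hx.1]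
  constructor <;> nlinarith

/-- Off the real axis the imaginary part `(1 - r) Im z` contributed by the identity function is
coercive; at real `x` the form of `1 + mixId r F x` is at least `(1 - r) (1 + x)`. -/
theorem IsRS.isUnit_one_add_mixId {F : ℂ → M →L[ℂ] M} (hF : IsRS F) {r : ℝ} (h0 : 0 ≤ r)
    (h1 : r < 1) {z : ℂ} (hz : z ∈ cutPlane) : IsUnit (1 + mixId r F z) := by
  have hr : 0 < 1 - r := by linarith
  have hform : ∀ f, inner ℂ f ((1 + mixId r F z) f) = ((‖f‖ ^ 2 : ℝ) : ℂ) +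
      ((r : ℂ) * inner ℂ f (F z f) + ((1 - r : ℝ) : ℂ) * (((‖f‖ ^ 2 : ℝ) : ℂ) * z)) := by
    intro f
    rw [add_apply, inner_add_right, inner_mixId, one_apply_eq_self, inner_self_eq_ofReal_norm_sq]
  rcases cutPlane_cases hz with h | ⟨x, hx, rfl⟩
  · refine isUnit_of_re_inner_ge ((z.im : ℂ) * -Complex.I) (δ := (1 - r) * z.im ^ 2)
      (by positivity) fun f => ?_
    have e : ∀ q : ℂ, ((z.im : ℂ) * -Complex.I * q).re = z.im * q.im := fun q => by
      rw [mul_assoc, Complex.re_ofReal_mul, neg_mul, Complex.neg_re, Complex.I_mul_re, neg_neg]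
    rw [hform, e]
    have h2 := mul_nonneg h0 (hF.nevanlinna.nevanlinna.mul_im_inner_nonneg h f)
    simp only [Complex.add_im, Complex.im_ofReal_mul, Complex.ofReal_im]
    linarith
  · refine isUnit_of_re_inner_ge 1 (δ := (1 - r) * (1 + x))
      (mul_pos hr (by linarith [hx.1])) fun f => ?_
    rw [hform, one_mul]
    simp only [Complex.add_re, Complex.re_ofReal_mul, Complex.ofReal_re]
    have h2 := abs_le.1 (hF.nevanlinna.isRS_iff.1 hF x hx f)
    nlinarith [mul_le_mul_of_nonneg_left h2.1 h0]

theorem IsRS.schwarz_pick_lower {F : ℂ → M →L[ℂ] M} (hF : IsRS F) {z : ℂ} (hz : z.im < 0) (h : M) :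
    0 ≤ ‖h‖ ^ 2 - ‖F z h‖ ^ 2 - (1 - ‖z‖ ^ 2) / z.im * (inner ℂ h (F z h)).im := by
  have hc : Continuous fun r : ℝ => ‖h‖ ^ 2 - ‖mixId r F z h‖ ^ 2 -
      (1 - ‖z‖ ^ 2) / z.im * (inner ℂ h (mixId r F z h)).im := by
    have h1 : Continuous fun r : ℝ => mixId r F z h := by
      simp only [mixId, add_apply, smul_apply, one_apply_eq_self]
      fun_prop
    have h2 : Continuous fun r : ℝ => (inner ℂ h (mixId r F z h)).im :=
      Complex.continuous_im.comp (continuous_const.inner h1)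
    fun_prop
  have hlim := (hc.tendsto 1).mono_left (nhdsWithin_le_nhds (s := Set.Iio 1))
  have h1 : mixId 1 F z = F z := by simp [mixId]
  rw [h1] at hlim
  refine ge_of_tendsto hlim ?_
  filter_upwards [Ioo_mem_nhdsLT (zero_lt_one' ℝ)] with r hr
  exact (hF.isRS_mixId hr.1.le hr.2.le).schwarz_pick_lower_of_isUnit
    (fun v hv => hF.isUnit_one_add_mixId hr.1.le hr.2 hv) hz h

theorem IsRS.schwarz_pick {F : ℂ → M →L[ℂ] M} (hF : IsRS F) {z : ℂ} (hz : z.im ≠ 0) (h : M) :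
    0 ≤ ‖h‖ ^ 2 - ‖F z h‖ ^ 2 - (1 - ‖z‖ ^ 2) / z.im * (inner ℂ h (F z h)).im := by
  rcases hz.lt_or_gt with h1 | h1
  · exact hF.schwarz_pick_lower h1 h
  · have := hF.neg_comp_neg.schwarz_pick_lower (z := -z) (by simpa using h1) h
    simpa [div_neg] using this

/-- Inside the unit disc both correction terms have a sign, so the Schwarz-Pick inequality makes the
values contractions; the bounds on the interval follow by continuity. -/
theorem IsNevanlinnaOnCutPlane.isRS_of_schwarz_pick {F : ℂ → M →L[ℂ] M}
    (hF : IsNevanlinnaOnCutPlane F) (h : ∀ z : ℂ, z.im ≠ 0 → ∀ f,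
      0 ≤ ‖f‖ ^ 2 - ‖F z f‖ ^ 2 - (1 - ‖z‖ ^ 2) / z.im * (inner ℂ f (F z f)).im) : IsRS F := by
  rw [hF.isRS_iff]
  intro x hx f
  have hc := hF.continuousAt (ofReal_mem_cutPlane.2 hx)
  have hc2 : ContinuousAt (fun z : ℂ => ‖F z f‖) x := (hc.clm_apply continuousAt_const).norm
  have hn : ‖F x f‖ ≤ ‖f‖ := by
    refine le_of_tendsto (tendsto_vertical hc2) ?_
    have hsmall : ContinuousAt (fun z : ℂ => ‖z‖) x := continuous_norm.continuousAt
    have hx1 : ‖(x : ℂ)‖ < 1 := by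
      rw [Complex.norm_real, Real.norm_eq_abs]; exact abs_lt.2 hx
    filter_upwards [self_mem_nhdsWithin, (tendsto_vertical hsmall).eventually_lt_const hx1]
      with y hy hy1
    have hy0 : 0 < y := hy
    have him : ((x : ℂ) + y * Complex.I).im = y := by simp
    have h1 := h (x + y * Complex.I) (by rw [him]; exact hy0.ne') f
    have h2 := hF.nevanlinna.mul_im_inner_nonneg (z := x + y * Complex.I)
      (by rw [him]; exact hy0.ne') f
    rw [him] at h1 h2
    have h3 := nonneg_of_mul_nonneg_right h2 hy0
    have h4 : 0 ≤ (1 - ‖(x : ℂ) + y * Complex.I‖ ^ 2) / y := by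
      refine div_nonneg ?_ hy0.le
      nlinarith [norm_nonneg ((x : ℂ) + y * Complex.I)]
    have h5 := mul_nonneg h4 h3
    exact le_of_sq_le_sq (by linarith) (norm_nonneg _)
  calc |(inner ℂ f (F x f)).re| ≤ ‖inner ℂ f (F x f)‖ := Complex.abs_re_le_norm _
    _ ≤ ‖f‖ * ‖F x f‖ := norm_inner_le_norm _ _
    _ ≤ ‖f‖ ^ 2 := by rw [sq]; gcongr

/-! ### The transform `Υ` -/

/-- Off the real axis `z⁻¹ - F z` has nonvanishing imaginary part, which makes `1 - z F z`
invertible; on `(-1, 1)` the operator `x F x` is a strict contraction. -/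
theorem IsRS.isUnit_one_sub_smul {F : ℂ → M →L[ℂ] M} (hF : IsRS F) {z : ℂ} (hz : z ∈ cutPlane) :
    IsUnit (1 - z • F z) := by
  have hform : ∀ f, inner ℂ f ((1 - z • F z) f) =
      ((‖f‖ ^ 2 : ℝ) : ℂ) - z * inner ℂ f (F z f) := by
    intro f
    rw [sub_apply, inner_sub_right, smul_apply, inner_smul_right, one_apply_eq_self,
      inner_self_eq_ofReal_norm_sq]
  rcases cutPlane_cases hz with h | ⟨x, hx, rfl⟩
  · refine isUnit_of_re_inner_ge ((z.im : ℂ) * (Complex.I * starRingEnd ℂ z)) (δ := z.im ^ 2)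
      (by positivity) fun f => ?_
    have e : (z.im : ℂ) * (Complex.I * starRingEnd ℂ z) *
        (((‖f‖ ^ 2 : ℝ) : ℂ) - z * inner ℂ f (F z f)) =
        (z.im : ℂ) * (Complex.I * (((‖f‖ ^ 2 : ℝ) : ℂ) * starRingEnd ℂ z -
          (Complex.normSq z : ℂ) * inner ℂ f (F z f))) := by
      rw [Complex.normSq_eq_conj_mul_self]
      ring
    rw [hform, e, Complex.re_ofReal_mul, Complex.I_mul_re, Complex.sub_im, Complex.im_ofReal_mul,
      Complex.im_ofReal_mul, Complex.conj_im]
    have h2 := mul_nonneg (Complex.normSq_nonneg z)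
      (hF.nevanlinna.nevanlinna.mul_im_inner_nonneg h f)
    linarith
  · have hx1 : |x| < 1 := abs_lt.2 hx
    refine isUnit_of_re_inner_ge 1 (δ := 1 - |x|) (by linarith) fun f => ?_
    rw [hform, one_mul, Complex.sub_re, Complex.re_ofReal_mul, Complex.ofReal_re]
    have h2 := hF.nevanlinna.isRS_iff.1 hF x hx f
    have h3 : x * (inner ℂ f (F x f)).re ≤ |x| * ‖f‖ ^ 2 :=
      (le_abs_self _).trans ((abs_mul _ _).trans_le (by gcongr))
    linarith

theorem IsNevanlinna.star_rsTransform {F : ℂ → M →L[ℂ] M} (hF : IsNevanlinna F) {z : ℂ}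
    (hz : z.im ≠ 0) : star (rsTransform F z) = rsTransform F (starRingEnd ℂ z) := by
  have hc : ∀ w, Commute (w • 1 - F w) (1 - w • F w) := fun w =>
    Commute.sub_left ((Commute.one_left _).smul_left _)
      (Commute.sub_right (Commute.one_right _) ((Commute.refl _).smul_right _))
  rw [rsTransform, rsTransform, star_mul, ← Ring.inverse_star, star_sub, star_sub, star_smul,
    star_smul, star_one, hF.symm z hz]
  by_cases hu : IsUnit (1 - starRingEnd ℂ z • F (starRingEnd ℂ z))
  · obtain ⟨v, hv⟩ := hu
    have h := hc (starRingEnd ℂ z)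
    rw [← hv] at h
    simp only [RCLike.star_def]
    rw [← hv, Ring.inverse_unit]
    exact h.units_inv_right.symm.eq
  · simp only [RCLike.star_def]
    rw [Ring.inverse_non_unit _ hu, mul_zero, zero_mul]

theorem IsRS.isRS_rsTransform {F : ℂ → M →L[ℂ] M} (hF : IsRS F) : IsRS (rsTransform F) := by
  have hd : DifferentiableOn ℂ (rsTransform F) cutPlane := by
    have h1 : DifferentiableOn ℂ (fun z => 1 - z • F z) cutPlane :=
      (differentiableOn_id.smul hF.nevanlinna.holo).const_sub 1
    have h2 : DifferentiableOn ℂ (fun z => Ring.inverse (1 - z • F z)) cutPlane :=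
      h1.inverse fun z hz => hF.isUnit_one_sub_smul hz
    exact ((differentiableOn_id.smul_const (1 : M →L[ℂ] M)).sub hF.nevanlinna.holo).mul h2
  have hN : IsNevanlinnaOnCutPlane (rsTransform F) :=
    { nevanlinna :=
        { holo := hd.mono fun z hz => mem_cutPlane_of_im_ne_zero hz
          symm := fun z hz => hF.nevanlinna.nevanlinna.star_rsTransform hz
          im_nonneg := fun z hz => by
            rw [im_smul_nonneg_iff]
            intro g
            obtain ⟨f, hg, hf⟩ := exists_rsTransform_apply
              (hF.isUnit_one_sub_smul (mem_cutPlane_of_im_ne_zero hz)) g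
            rw [hf, hg, inner_sub_smul_smul_sub_im]
            have h1 := mul_nonneg (mul_self_nonneg z.im) (hF.schwarz_pick hz f)
            refine h1.trans_eq ?_
            field_simp }
      holo := hd }
  rw [hN.isRS_iff]
  intro x hx g
  obtain ⟨f, hg, hf⟩ := exists_rsTransform_apply
    (hF.isUnit_one_sub_smul (ofReal_mem_cutPlane.2 hx)) g
  have hle : ‖rsTransform F x g‖ ≤ ‖g‖ := by
    rw [hf, hg]
    exact norm_smul_sub_le_norm_sub_smul (abs_lt.2 hx).le (hF.norm_apply_le hx f)
  calc |(inner ℂ g (rsTransform F x g)).re|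
      ≤ ‖inner ℂ g (rsTransform F x g)‖ := Complex.abs_re_le_norm _
    _ ≤ ‖g‖ * ‖rsTransform F x g‖ := norm_inner_le_norm _ _
    _ ≤ ‖g‖ ^ 2 := by rw [sq]; gcongr

/-- `rsKernel F` is congruent to the Nevanlinna kernel of `Υ`. -/
theorem rsKernel_eq {F : ℂ → M →L[ℂ] M} {z w : ℂ} (hz : IsUnit (1 - z • F z))
    (hw : IsUnit (1 - w • F w)) (hzw : z - starRingEnd ℂ w ≠ 0) :
    rsKernel F z w = star (1 - w • F w) *
      ((z - starRingEnd ℂ w)⁻¹ • (rsTransform F z - star (rsTransform F w))) *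
        (1 - z • F z) := by
  have h1 : star (1 - w • F w) * star (rsTransform F w) = star (w • 1 - F w) := by
    rw [← star_mul, rsTransform_mul hw]
  rw [mul_smul_comm, smul_mul_assoc, mul_sub (star (1 - w • F w)), h1,
    sub_mul _ _ (1 - z • F z), mul_assoc, rsTransform_mul hz]
  have h2 : star (1 - w • F w) * (z • 1 - F z) - star (w • 1 - F w) * (1 - z • F z) =
      (z - starRingEnd ℂ w) • (1 - star (F w) * F z) -
        (1 - starRingEnd ℂ w * z) • (F z - star (F w)) := by
    simp only [star_sub, star_one, star_smul, mul_sub, sub_mul, one_mul, mul_one, smul_mul_assoc,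
      mul_smul_comm, smul_sub, RCLike.star_def]
    module
  rw [h2, smul_sub, smul_smul, inv_mul_cancel₀ hzw, one_smul, smul_smul, rsKernel, div_eq_inv_mul]

theorem isNonnegKernelOn_rsKernel {F : ℂ → M →L[ℂ] M}
    (hU : ∀ z ∈ cutPlane, IsUnit (1 - z • F z)) (hR : IsRS (rsTransform F)) :
    IsNonnegKernelOn (rsKernel F) (cutPlane ∩ {z : ℂ | 0 < z.im}) ∧
      IsNonnegKernelOn (rsKernel F) (cutPlane ∩ {z : ℂ | z.im < 0}) := by
  constructor
  · refine ((hR.nevanlinna.nevanlinna.kernel_nonneg_upper.comp (τ := id)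
      fun z hz => hz.2).conj_mul fun z => 1 - z • F z).congr fun z hz w hw =>
        rsKernel_eq (hU z hz.1) (hU w hw.1) fun h => ?_
    have h1 := congrArg Complex.im h
    have h2 : 0 < z.im := hz.2
    have h3 : 0 < w.im := hw.2
    simp only [Complex.sub_im, Complex.conj_im, Complex.zero_im] at h1
    linarith
  · refine ((hR.nevanlinna.nevanlinna.kernel_nonneg_lower.comp (τ := id)
      fun z hz => hz.2).conj_mul fun z => 1 - z • F z).congr fun z hz w hw =>
        rsKernel_eq (hU z hz.1) (hU w hw.1) fun h => ?_
    have h1 := congrArg Complex.im h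
    have h2 : z.im < 0 := hz.2
    have h3 : w.im < 0 := hw.2
    simp only [Complex.sub_im, Complex.conj_im, Complex.zero_im] at h1
    linarith

/-- On the diagonal the kernel is the operator of the Schwarz-Pick inequality. -/
theorem rsKernel_self {F : ℂ → M →L[ℂ] M} {z : ℂ} :
    rsKernel F z z = 1 - star (F z) * F z -
      (((1 - ‖z‖ ^ 2) / z.im : ℝ) : ℂ) • (ℑ (F z) : M →L[ℂ] M) := by
  rw [rsKernel, imaginaryPart_apply_coe, ← Complex.coe_smul, smul_smul, smul_smul,
    Complex.sub_conj, ← Complex.normSq_eq_conj_mul_self, Complex.normSq_eq_norm_sq]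
  congr 2
  push_cast
  rw [div_eq_mul_inv, mul_inv, Complex.inv_I]
  ring

end

theorem theorem4p1 {M : Type*} [NormedAddCommGroup M] [InnerProductSpace ℂ M] [CompleteSpace M]
    (Ω : ℂ → M →L[ℂ] M) (hΩ : IsNevanlinnaOnCutPlane Ω) :
    List.TFAE [
      IsRS Ω,
      ∀ z : ℂ, z.im ≠ 0 →
        0 ≤ 1 - star (Ω z) * Ω z -
          (((1 - ‖z‖ ^ 2) / z.im : ℝ) : ℂ) • (ℑ (Ω z) : M →L[ℂ] M),
      IsNonnegKernelOn (rsKernel Ω) (cutPlane ∩ {z : ℂ | 0 < z.im}) ∧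
        IsNonnegKernelOn (rsKernel Ω) (cutPlane ∩ {z : ℂ | z.im < 0}),
      (∀ z ∈ cutPlane, IsUnit (1 - z • Ω z)) ∧ IsRS (rsTransform Ω)] := by
  tfae_have 1 → 4 := fun h => ⟨fun z hz => h.isUnit_one_sub_smul hz, h.isRS_rsTransform⟩
  tfae_have 4 → 3 := fun h => isNonnegKernelOn_rsKernel h.1 h.2
  tfae_have 3 → 2 := by
    rintro ⟨hup, hlow⟩ z hz
    rw [← rsKernel_self,
      nonneg_iff_inner_of_isSelfAdjoint (by rw [rsKernel_self]; simp)]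
    intro f
    have hmem := mem_cutPlane_of_im_ne_zero hz
    rcases hz.lt_or_gt with h | h
    · have := hlow 1 (fun _ => z) (fun _ => f) fun _ => ⟨hmem, h⟩
      simpa using (Complex.le_def.1 this).1
    · have := hup 1 (fun _ => z) (fun _ => f) fun _ => ⟨hmem, h⟩
      simpa using (Complex.le_def.1 this).1
  tfae_have 2 → 1 := fun h => hΩ.isRS_of_schwarz_pick fun z hz =>
    one_sub_star_mul_self_sub_smul_nonneg_iff.1 (h z hz)
  tfae_finish
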